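/- Let $n\ge 0$, $k\ge 1$ be integers, $V=[n]$, and let $(k+1)^V$ be the set of vectors $\boldsymbol x=(X_1,\dots,X_k)$ of pairwise disjoint subsets of $V$ (write $\boldsymbol x(e)=i$ if $e\in X_i$, and $\boldsymbol x(e)=0$ if $e$ is in no $X_i$). For $f:(k+1)^V\to\mathbb R$ and $\boldsymbol x(e)=0$ let $\Delta_{e,i}f(\boldsymbol x)=f(\boldsymbol x\text{ with }e\text{ added to }X_i)-f(\boldsymbol x)$. The function $f$ is monotone if all these $\Delta_{e,i}f(\boldsymbol x)$ are $\ge 0$, and $k$-submodular if $f(\boldsymbol x)+f(\boldsymbol y)\ge f(\boldsymbol x\sqcup\boldsymbol y)+f(\boldsymbol x\sqcap\boldsymbol y)$ for all $\boldsymbol x,\boldsymbol y$, where $(\boldsymbol x\sqcap\boldsymbol y)_i=X_i\cap Y_i$ and $(\boldsymbol x\sqcup\boldsymbol y)_i=(X_i\cup Y_i)\setminus\bigcup_{j\ne i}(X_j\cup Y_j)$. **Bandit problem.** Let $f_1,f_2,\dots$ be independent random functions $(k+1)^V\to[0,1]$ such that, for each action $\boldsymbol x$, the law of $f_t(\boldsymbol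 x)$ does not depend on $t$. Put $f(\boldsymbol x)=\mathbb E[f_t(\boldsymbol x)]$. In each round $t=1,\dots,T$ the learner plays an action $A_t\in(k+1)^V$ (there is no constraint) and observes only $f_t(A_t)$. The expected cumulative $\alpha$-regret is $\mathbb E[\mathcal R_T]=\alpha T\max_{\boldsymbol x}f(\boldsymbol x)-\mathbb E\big[\sum_{t=1}^T f_t(A_t)\big]$, the expectation being over the rewards and the learner's internal randomness. **Offline algorithm $\mathcal A$ (modified algorithm of Iwata et al.).** Let $t=k-1$ and $[x]_+=\max(x,0)$. Start with $\boldsymbol s=\boldsymbol 0$ and query the value of $\boldsymbol 0$. For each $e\in V$, in an arbitrary fixed order: query the values of the $k$ vectors obtained from $\boldsymbol s$ by setting $\boldsymbol s(e)=i$, $i\in[k]$; let $y_i$ be the answer minus the (already received) answer for $\boldsymbol s$; let $\beta=\sum_{i=1}^k[y_i]_+^t$; if $\beta\ne0$ let $p_i=[y_i]_+^t/\beta$, and otherwise let $p_1=1$ and $p_i=0$ for $i\neq 1$; (if $k=1$, then $p_1=1$ in either case); set $\boldsymbol s(e)=i$ with probability $p_i$. Return $\boldsymbol s$. **C-ETC.**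 Given a horizon $T$, an offline algorithm, and parameters $\delta,N$, put $m=\Big\lceil\frac{\delta^{2/3}T^{2/3}\log(T)^{1/3}}{2N^{2/3}}\Big\rceil$ (with $m=0$ if $N=0$). Run the offline algorithm; whenever it queries the value of an action, play this action $m$ times and return the empirical mean of the $m$ rewards (or $0$ if $m=0$) as the answer. When the offline algorithm stops, play its output in all remaining rounds. Play stops after round $T$ in any case. **Claim.** There is an absolute constant $C>0$ such that for all $n,k,T$, all orders of $V$ and all reward processes as above for which $f$ is monotone and $k$-submodular, if $T\ge\max\Big\{nk,\frac{2\sqrt2\,k}{16-\frac2k}\Big\}$, then C-ETC with offline algorithm $\mathcal A$ and parameters $\delta=(16-\tfrac2k)n$, $N=nk$ has expected cumulative $\frac{k}{2k-1}$-regret $$\mathbb E[\mathcal R_T]\le C\,n\,k^{1/3}\,T^{2/3}\log(T)^{1/3}.$$ -/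

import Mathlib

open MeasureTheory ProbabilityTheory

noncomputable section

/-! ## k-submodular functions -/

/-- `(k+1)^V` with `V = Fin n`: each element has a type in `Fin k`, or no type (`none`).
The `i`-th part of `x` is `{e | x e = some i}`; these parts are pairwise disjoint. -/
abbrev KVec (n k : ℕ) : Type := Fin n → Option (Fin k)

namespace KVec

variable {n k : ℕ}

/-- `0`, the vector in which no element has a type. -/
def zero (n k : ℕ) : KVec n k := fun _ => none

/-- `x ⊓ y`, the partwise intersection. -/
def meet (x y : KVec n k) : KVec n k := fun e => if x e = y e then x e else none

/-- `x ⊔ y`, the partwise union, from which every element that would get two different types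
is removed. -/
def join (x y : KVec n k) : KVec n k := fun e =>
  if x e = none then y e else if y e = none then x e else if x e = y e then x e else none

theorem meet_eq_some (x y : KVec n k) (e : Fin n) (i : Fin k) :
    meet x y e = some i ↔ x e = some i ∧ y e = some i := by
  unfold meet
  split_ifs with h
  · rw [← h]; simp
  · simp only [false_iff]
    rintro ⟨h1, h2⟩
    exact h (h1.trans h2.symm)

theorem join_eq_some (x y : KVec n k) (e : Fin n) (i : Fin k) :
    join x y e = some i ↔
      (x e = some i ∨ y e = some i) ∧ ∀ j, j ≠ i → ¬ (x e = some j ∨ y e = some j) := by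
  unfold join
  rcases hx : x e with _ | a <;> rcases hy : y e with _ | b <;> grind

/-- Assign type `i` to the element `e`. -/
def assign (x : KVec n k) (e : Fin n) (i : Fin k) : KVec n k := Function.update x e (some i)

/-- The marginal gain `Δ_{e,i} f(x)`. -/
def marginal (f : KVec n k → ℝ) (e : Fin n) (i : Fin k) (x : KVec n k) : ℝ :=
  f (x.assign e i) - f x

/-- `f` is `k`-submodular. -/
def KSubmodular (f : KVec n k → ℝ) : Prop :=
  ∀ x y, f (join x y) + f (meet x y) ≤ f x + f y

/-- `f` is monotone: all marginal gains of elements without a type are nonnegative. -/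
def IsMonotone (f : KVec n k → ℝ) : Prop :=
  ∀ x e i, x e = none → 0 ≤ marginal f e i x

end KVec

/-! ## Randomized algorithms with a value oracle -/

/-- A randomized algorithm that may query the values of actions in `A`, may draw elements of `ι`
from distributions of its choice, and returns an action. -/
inductive OracleAlg (A ι : Type) : Type
  /-- return an action -/
  | ret (a : A) : OracleAlg A ι
  /-- query the value of `a` and go on with the answer -/
  | query (a : A) (next : ℝ → OracleAlg A ι) : OracleAlg A ι
  /-- draw an element with distribution `p` and go on with it -/
  | sample (p : PMF ι) (next : ι → OracleAlg A ι) : OracleAlg A ι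

/-- The law of (list of queried actions in order, returned action), over the internal randomness
of the algorithm, when the `q`-th query (counted from the second argument on) is answered
by `ans q a` if it asks for the value of `a`. -/
def OracleAlg.law {A ι : Type} (ans : ℕ → A → ℝ) : OracleAlg A ι → ℕ → PMF (List A × A)
  | .ret a, _ => PMF.pure ([], a)
  | .query a next, q =>
      (OracleAlg.law ans (next (ans q a)) (q + 1)).map fun r => (a :: r.1, r.2)
  | .sample p next, q => p.bind fun i => OracleAlg.law ans (next i) q

/-! ## The offline algorithm -/

section Offline

variable {n k : ℕ}

/-- With `t = k - 1` and `β = ∑ j, [y j]_+ ^ t`: the probability `[y i]_+ ^ t / β` of type `i` if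
`β ≠ 0`; otherwise the first type has probability `1`. -/
def typeProb [NeZero k] (y : Fin k → ℝ) (i : Fin k) : ℝ :=
  if ∑ j, (max (y j) 0) ^ (k - 1) ≠ 0 then
    (max (y i) 0) ^ (k - 1) / ∑ j, (max (y j) 0) ^ (k - 1)
  else if i = 0 then 1 else 0

theorem typeProb_nonneg [NeZero k] (y : Fin k → ℝ) (i : Fin k) : 0 ≤ typeProb y i := by
  unfold typeProb
  split_ifs <;> positivity

theorem sum_typeProb [NeZero k] (y : Fin k → ℝ) : ∑ i, typeProb y i = 1 := by
  unfold typeProb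
  split_ifs with h
  · rw [← Finset.sum_div, div_self h]
  · simp

/-- The distribution on types with the probabilities `typeProb y`. -/
def typePMF [NeZero k] (y : Fin k → ℝ) : PMF (Fin k) :=
  PMF.ofFintype (fun i => ENNReal.ofReal (typeProb y i)) (by
    rw [← ENNReal.ofReal_sum_of_nonneg fun i _ => typeProb_nonneg y i, sum_typeProb]
    simp)

/-- Query `a i` for the `i` of a list in turn, record the answers in `h`, and go on with them. -/
def queryTypes {A : Type} (a : Fin k → A) (next : (Fin k → ℝ) → OracleAlg A (Fin k)) :
    List (Fin k) → (Fin k → ℝ) → OracleAlg A (Fin k)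
  | [], h => next h
  | i :: l, h => .query (a i) fun r => queryTypes a next l (Function.update h i r)

/-- The main loop, with `s` the current vector and `v` the oracle's answer for `s`. For the next
element `e`, query the values of `s` with type `i` assigned to `e`, for `i` in `Fin k`; subtract `v`
to get the marginal gains; draw the type of `e`. The answer for the new vector is already known. -/
def iwataLoop [NeZero k] : List (Fin n) → KVec n k → ℝ → OracleAlg (KVec n k) (Fin k)
  | [], s, _ => .ret s
  | e :: l, s, v =>
      queryTypes (fun i => s.assign e i)
        (fun h => .sample (typePMF fun i => h i - v) fun i => iwataLoop l (s.assign e i) (h i))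
        (List.finRange k) 0

/-- The modified algorithm of Iwata et al. for monotone `k`-submodular functions without
constraints. It visits the elements in the order `σ 0, σ 1, …`. -/
def modifiedIwata [NeZero k] (σ : Equiv.Perm (Fin n)) : OracleAlg (KVec n k) (Fin k) :=
  .query (KVec.zero n k) fun v => iwataLoop ((List.finRange n).map σ) (KVec.zero n k) v

end Offline

/-! ## Stochastic bandits with full-bandit feedback and C-ETC -/

section Bandit

variable {A ι Ω : Type*} [MeasurableSpace Ω]

/-- `X t a` is the reward `f_t(a)` of the action `a` in round `t` (rounds are `0, 1, 2, …`).
The random functions `f_t` are independent, the law of `f_t(a)` does not depend on `t`, and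
rewards lie in `[0,1]`. The rewards of different actions in one round may be dependent. -/
structure IsRewardProcess (μ : Measure Ω) (X : ℕ → A → Ω → ℝ) : Prop where
  measurable : ∀ t a, Measurable (X t a)
  mem_Icc : ∀ t a, ∀ᵐ ω ∂μ, X t a ω ∈ Set.Icc (0 : ℝ) 1
  indep : iIndepFun (fun t ω a => X t a ω) μ
  identDistrib : ∀ t a, IdentDistrib (X t a) (X 0 a) μ μ

/-- The expected reward function `f(a) = 𝔼[f_t(a)]`. -/
def expectedReward (μ : Measure Ω) (X : ℕ → A → Ω → ℝ) (a : A) : ℝ := ∫ ω, X 0 a ω ∂μ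

/-- The number `m` of times that C-ETC plays each queried action. -/
def cetcPlays (T : ℕ) (δ N : ℝ) : ℕ :=
  ⌈δ ^ (2 / 3 : ℝ) * (T : ℝ) ^ (2 / 3 : ℝ) * Real.log T ^ (1 / 3 : ℝ) / (2 * N ^ (2 / 3 : ℝ))⌉₊

/-- The empirical mean that answers the `q`-th query (`q = 0, 1, …`) if it is for the action `a`:
C-ETC plays `a` in the `m` rounds `q * m, …, q * m + m - 1`. -/
def cetcAnswer (m : ℕ) (X : ℕ → A → Ω → ℝ) (ω : Ω) (q : ℕ) (a : A) : ℝ :=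
  (∑ j ∈ Finset.range m, X (q * m + j) a ω) / m

/-- The action that C-ETC plays in round `t`, where `r.1` lists the queries of the offline algorithm
and `r.2` is its output: each queried action `m` times in turn, then the output for ever. -/
def cetcAction (m : ℕ) (r : List A × A) (t : ℕ) : A :=
  if t < m * r.1.length then r.1.getD (t / m) r.2 else r.2

/-- `𝔼[∑_{t<T} f_t(A_t)]` for C-ETC with the offline algorithm `alg` and parameters `δ`, `N`: the
expectation over the rewards of the expectation over the internal randomness of `alg`, which is
fresh: the law of each draw depends only on the answers received before. Exploration that
has not ended by round `T` is cut off. -/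
def cetcExpectedTotalReward {A ι : Type} (μ : Measure Ω) (X : ℕ → A → Ω → ℝ)
    (alg : OracleAlg A ι) (δ N : ℝ) (T : ℕ) : ℝ :=
  ∫ ω, ∑' r : List A × A,
    (alg.law (cetcAnswer (cetcPlays T δ N) X ω) 0 r).toReal *
      ∑ t ∈ Finset.range T, X t (cetcAction (cetcPlays T δ N) r t) ω ∂μ

/-- The expected cumulative `α`-regret
`α T max_a f(a) - 𝔼[∑_{t<T} f_t(A_t)]` of C-ETC, where every element of `A` is feasible. -/
def cetcRegret {A ι : Type} (μ : Measure Ω) (X : ℕ → A → Ω → ℝ)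
    (alg : OracleAlg A ι) (α δ N : ℝ) (T : ℕ) : ℝ :=
  α * T * (⨆ a, expectedReward μ X a) - cetcExpectedTotalReward μ X alg δ N T

end Bandit

end

/-! ## Greedy steps for monotone `k`-submodular functions -/

/-! Fix an optimal vector `o` and follow the potential `F s = f (fill s o) + (1 - 1/k) * f s` along
the greedy algorithm. It starts at `f o + (1 - 1/k) * f 0 ≥ f o` and ends at `(2 - 1/k) * f s`,
because `fill s o = s` once every element has a type. So if `F` does not decrease in expectation,
the output has expected value at least `k / (2k - 1)` times the optimum.

That one step does not decrease `F` is a statement about the probabilities `p i` proportional to `y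
i ^ (k - 1)`. If `o` gives `e` the type `j`, the completion loses at most `(1 - p j)` times the gain
of `j` (by monotonicity, and by decreasing marginal gains), and the weighted AM-GM inequality bounds
this by `(1 - 1/k)` times the expected gain of `f s` (`one_sub_typeProb_mul_le`). Answers within `ρ`
of the truth cost `4ρ` per step; a worse answer costs at most `1`, since `f ≤ 1`
(`KVec.fill_add_le_sum_typeProb`).

With empirical means as answers, the draws depend on the rewards seen so far.
`integral_mul_loopExpect_ge` carries the potential through the random path, using that distinct
rounds are independent; Hoeffding's inequality bounds the probability of each bad answer.
Exploration takes `m * (n * k + 1)` rounds with regret at most `1` each, and every later round costs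
about `4nρ`. With `ρ = √(log T / m)` the prescribed `m` balances the two. -/

namespace KVec

variable {n k : ℕ} {f : KVec n k → ℝ}

/-- `s`, in which the elements without a type get the type that they have in `o`. -/
def fill (s o : KVec n k) : KVec n k := fun e => if s e = none then o e else s e

/-- The marginal gains of a `k`-submodular function are decreasing. -/
theorem KSubmodular.marginal_le (hf : KSubmodular f) {s u : KVec n k} {e : Fin n} (i : Fin k)
    (hsu : ∀ a, s a = none ∨ s a = u a) (hs : s e = none) (hu : u e = none) :
    marginal f e i u ≤ marginal f e i s := by
  -- `k`-submodularity is applied to `s.assign e i` and `u`: since `u` extends `s`, the join adds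
  -- `e` to `u` and the meet is `s`.
  have hj : join (s.assign e i) u = u.assign e i := by
    funext a
    by_cases ha : a = e
    · subst ha; simp [join, assign, hu]
    · have := hsu a
      simp only [join, assign, Function.update_of_ne ha]
      grind
  have hm : meet (s.assign e i) u = s := by
    funext a
    by_cases ha : a = e
    · subst ha; simp [meet, assign, hu, hs]
    · have := hsu a
      simp only [meet, assign, Function.update_of_ne ha]
      grind
  have := hf (s.assign e i) u
  rw [hj, hm] at this
  unfold marginal
  linarith

end KVec

/-- A weighted inequality of arithmetic and geometric means. -/
theorem pow_mul_le_add_pow {a b : ℝ} (ha : 0 ≤ a) (hb : 0 ≤ b) (t : ℕ) :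
    (t + 1) * (a ^ t * b) ≤ t * a ^ (t + 1) + b ^ (t + 1) := by
  induction t with
  | zero => simp
  | succ t ih =>
    -- Both factors have the same sign. Adding this inequality to `a` times the induction hypothesis
    -- gives the next case.
    have h1 : 0 ≤ (a ^ (t + 1) - b ^ (t + 1)) * (a - b) := by
      rcases le_total a b with h | h
      · exact mul_nonneg_of_nonpos_of_nonpos
          (sub_nonpos.2 (pow_le_pow_left₀ ha h _)) (sub_nonpos.2 h)
      · exact mul_nonneg (sub_nonneg.2 (pow_le_pow_left₀ hb h _)) (sub_nonneg.2 h)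
    have h2 := mul_le_mul_of_nonneg_left ih ha
    push_cast
    simp only [pow_succ] at *
    nlinarith

/-! ### The type probabilities: exact and perturbed gains -/

section TypeProb

variable {k : ℕ} [NeZero k]

theorem typeProb_le_one (y : Fin k → ℝ) (i : Fin k) : typeProb y i ≤ 1 := by
  rw [← sum_typeProb y]
  exact Finset.single_le_sum (fun j _ => typeProb_nonneg y j) (Finset.mem_univ i)

/-- With `z = [y]_+`, clearing denominators leaves `k * ∑_{i ≠ j} z i ^ (k-1) * z j ≤ (k-1) * ∑ i, z
i ^ k`. AM-GM applied to each `i ≠ j` yields this, the `k - 1` copies of `z j ^ k` supplying the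
missing term `i = j`. -/
theorem one_sub_typeProb_mul_le (y : Fin k → ℝ) (j : Fin k) :
    (1 - typeProb y j) * max (y j) 0 ≤ (1 - 1 / k) * ∑ i, typeProb y i * max (y i) 0 := by
  obtain ⟨t, rfl⟩ : ∃ t, k = t + 1 := ⟨k - 1, (Nat.succ_pred_eq_of_ne_zero (NeZero.ne k)).symm⟩
  set z : Fin (t + 1) → ℝ := fun i => max (y i) 0 with hz
  have hz0 : ∀ i, 0 ≤ z i := fun i => le_max_right _ _
  have hp : ∀ i, typeProb y i = if ∑ j, z j ^ t ≠ 0 then z i ^ t / ∑ j, z j ^ t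
      else if i = 0 then 1 else 0 := fun i => rfl
  change (1 - typeProb y j) * z j ≤ (1 - 1 / _) * ∑ i, typeProb y i * z i
  -- A vanishing sum forces all `z i = 0` (for `t = 0` it cannot vanish), and then both sides are
  -- `0` whatever the default distribution is.
  by_cases hβ : ∑ j, z j ^ t = 0
  · have h0 : ∀ i, z i = 0 := fun i =>
      eq_zero_of_pow_eq_zero
        ((Finset.sum_eq_zero_iff_of_nonneg fun i _ => pow_nonneg (hz0 i) t).1 hβ i
          (Finset.mem_univ i))
    simp [h0]
  · have hβ0 : 0 < ∑ j, z j ^ t :=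
      lt_of_le_of_ne (Finset.sum_nonneg fun i _ => pow_nonneg (hz0 i) t) (Ne.symm hβ)
    simp only [hp, ne_eq, hβ, not_false_eq_true, if_true]
    set β := ∑ j, z j ^ t with hβd
    have hsum : ∑ i, z i ^ t / β * z i = (∑ i, z i ^ (t + 1)) / β := by
      rw [Finset.sum_div]
      exact Finset.sum_congr rfl fun i _ => by ring
    rw [hsum, mul_div_assoc', le_div_iff₀ hβ0]
    have hkey : (t + 1 : ℝ) * ((β - z j ^ t) * z j) ≤ t * ∑ i, z i ^ (t + 1) := by
      have h1 : β - z j ^ t = ∑ i ∈ Finset.univ.erase j, z i ^ t := by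
        rw [hβd, ← Finset.add_sum_erase _ _ (Finset.mem_univ j)]; ring
      have h2 : ∑ i, z i ^ (t + 1) = z j ^ (t + 1) + ∑ i ∈ Finset.univ.erase j, z i ^ (t + 1) :=
        (Finset.add_sum_erase _ _ (Finset.mem_univ j)).symm
      have h3 := Finset.sum_le_sum fun i (_ : i ∈ Finset.univ.erase j) =>
        pow_mul_le_add_pow (hz0 i) (hz0 j) t
      rw [Finset.sum_add_distrib, ← Finset.mul_sum, ← Finset.mul_sum, ← Finset.sum_mul] at h3
      have h4 : ∑ i ∈ Finset.univ.erase j, z j ^ (t + 1) = t * z j ^ (t + 1) := by simp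
      rw [h1, h2]
      linarith
    have e1 : (1 - z j ^ t / β) * z j * β = (β - z j ^ t) * z j := by field_simp
    rw [e1]
    have ht : (0 : ℝ) < t + 1 := by positivity
    have e2 : (1 - 1 / ((t + 1 : ℕ) : ℝ)) * ∑ i, z i ^ (t + 1)
        = (t * ∑ i, z i ^ (t + 1)) / (t + 1) := by
      push_cast; field_simp; ring
    rw [e2, le_div_iff₀ ht]
    linarith

/-- Since `w ≥ 0`, truncating `y` at `0` keeps it within `ε` of `w`. Passing from `w` to `[y]_+` on
the left and back on the right costs one `ε` each, with factors at most `1`. -/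
theorem one_sub_typeProb_mul_le_of_abs_sub_le {y w : Fin k → ℝ} {ε : ℝ} (hw : ∀ i, 0 ≤ w i)
    (h : ∀ i, |y i - w i| ≤ ε) (j : Fin k) :
    (1 - typeProb y j) * w j ≤ (1 - 1 / k) * ∑ i, typeProb y i * w i + 2 * ε := by
  have hz1 : ∀ i, w i ≤ max (y i) 0 + ε := fun i => by
    have := abs_le.1 (h i); linarith [le_max_left (y i) 0]
  have hε : 0 ≤ ε := (abs_nonneg _).trans (h j)
  have hz2 : ∀ i, max (y i) 0 ≤ w i + ε := fun i => by
    have := abs_le.1 (h i)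
    exact max_le (by linarith) (by linarith [hw i])
  have hk : (1 : ℝ) ≤ k := by exact_mod_cast NeZero.one_le
  have hk1 : 0 ≤ 1 - 1 / (k : ℝ) := by
    rw [sub_nonneg, div_le_one (by linarith)]; exact hk
  have hk2 : 1 - 1 / (k : ℝ) ≤ 1 := by
    have : 0 ≤ 1 / (k : ℝ) := by positivity
    linarith
  have hs : ∑ i, typeProb y i * max (y i) 0 ≤ ∑ i, typeProb y i * w i + ε := by
    calc ∑ i, typeProb y i * max (y i) 0 ≤ ∑ i, typeProb y i * (w i + ε) :=
          Finset.sum_le_sum fun i _ => mul_le_mul_of_nonneg_left (hz2 i) (typeProb_nonneg y i)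
      _ = _ := by simp only [mul_add, Finset.sum_add_distrib, ← Finset.sum_mul, sum_typeProb,
          one_mul]
  have h1 := one_sub_typeProb_mul_le y j
  have h2 := typeProb_le_one y j
  have h3 := typeProb_nonneg y j
  have h4 := mul_le_mul_of_nonneg_left (hz1 j) (sub_nonneg.2 h2)
  have h5 := mul_le_mul_of_nonneg_left hs hk1
  nlinarith

end TypeProb

/-- `1` if `d` has absolute value greater than `ρ`, and `0` otherwise. -/
noncomputable def exceeds (ρ d : ℝ) : ℝ := if ρ < |d| then 1 else 0

theorem exceeds_nonneg (ρ d : ℝ) : 0 ≤ exceeds ρ d := by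
  unfold exceeds; split_ifs <;> norm_num

theorem exceeds_le_one (ρ d : ℝ) : exceeds ρ d ≤ 1 := by
  unfold exceeds; split_ifs <;> norm_num

namespace KVec

variable {n k : ℕ} [NeZero k] {f : KVec n k → ℝ}

/-- One step of the greedy algorithm with inexact values `v` of `f s` and `h i` of
`f (s.assign e i)`: the expected loss of the completion by `o` is at most `1 - 1 / k` times the
expected gain, up to an error. -/
theorem fill_add_le_sum_typeProb (hsub : KSubmodular f) (hmon : IsMonotone f)
    (hf : ∀ x, f x ∈ Set.Icc (0 : ℝ) 1) (o : KVec n k) {s : KVec n k} {e : Fin n}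
    (hs : s e = none) {ρ : ℝ} (hρ : 0 ≤ ρ) (v : ℝ) (h : Fin k → ℝ) :
    f (fill s o) + (1 - 1 / k) * f s
        - (4 * ρ + exceeds ρ (v - f s) + ∑ i, exceeds ρ (h i - f (s.assign e i))) ≤
      ∑ i, typeProb (fun i => h i - v) i *
        (f (fill (s.assign e i) o) + (1 - 1 / k) * f (s.assign e i)) := by
  set p := typeProb fun i => h i - v with hp
  have hp0 : ∀ i, 0 ≤ p i := typeProb_nonneg _
  have hp1 : ∑ i, p i = 1 := sum_typeProb _
  have hgain : ∀ i, 0 ≤ marginal f e i s := fun i => hmon s e i hs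
  have hk : (1 : ℝ) ≤ k := by exact_mod_cast NeZero.one_le
  have hk1 : 0 ≤ 1 - 1 / (k : ℝ) := by
    rw [sub_nonneg, div_le_one (by linarith)]; exact hk
  have hE0 : ∀ i, 0 ≤ exceeds ρ (h i - f (s.assign e i)) := fun i => exceeds_nonneg _ _
  have hEs : 0 ≤ ∑ i, exceeds ρ (h i - f (s.assign e i)) := Finset.sum_nonneg fun i _ => hE0 i
  have hsplit : ∑ i, p i * (f (fill (s.assign e i) o) + (1 - 1 / k) * f (s.assign e i)) =
      ∑ i, p i * f (fill (s.assign e i) o) + (1 - 1 / k) * ∑ i, p i * marginal f e i s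
        + (1 - 1 / k) * f s := by
    have : (1 - 1 / (k : ℝ)) * f s = ∑ i, p i * ((1 - 1 / k) * f s) := by
      rw [← Finset.sum_mul, hp1, one_mul]
    rw [this, Finset.mul_sum, ← Finset.sum_add_distrib, ← Finset.sum_add_distrib]
    exact Finset.sum_congr rfl fun i _ => by unfold marginal; ring
  have hG : 0 ≤ (1 - 1 / (k : ℝ)) * ∑ i, p i * marginal f e i s :=
    mul_nonneg hk1 (Finset.sum_nonneg fun i _ => mul_nonneg (hp0 i) (hgain i))
  have hF : 0 ≤ ∑ i, p i * f (fill (s.assign e i) o) :=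
    Finset.sum_nonneg fun i _ => mul_nonneg (hp0 i) (hf _).1
  rw [hsplit]
  -- If some answer is off by more than `ρ`, the subtracted error is at least `1 ≥ f (fill s o)`,
  -- and the other terms on the right are nonnegative.
  by_cases hgood : |v - f s| ≤ ρ ∧ ∀ i, |h i - f (s.assign e i)| ≤ ρ
  swap
  · have : 1 ≤ exceeds ρ (v - f s) + ∑ i, exceeds ρ (h i - f (s.assign e i)) := by
      rw [not_and_or, not_le, not_forall] at hgood
      rcases hgood with hb | ⟨i, hi⟩
      · have : exceeds ρ (v - f s) = 1 := if_pos hb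
        linarith
      · have h1 : exceeds ρ (h i - f (s.assign e i)) = 1 := if_pos (not_le.1 hi)
        have h2 := Finset.single_le_sum (fun i _ => hE0 i) (Finset.mem_univ i)
        linarith [exceeds_nonneg ρ (v - f s)]
    linarith [(hf (fill s o)).2]
  have hEv := exceeds_nonneg ρ (v - f s)
  -- the completion with `e` removed
  set u : KVec n k := Function.update (fill s o) e none with hu
  have hue : u e = none := by simp [hu]
  have hsu : ∀ a, s a = none ∨ s a = u a := fun a => by
    by_cases ha : a = e
    · subst ha; exact Or.inl hs
    · by_cases hsa : s a = none
      · exact Or.inl hsa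
      · right; simp [hu, Function.update_of_ne ha, fill, hsa]
  have hfill : ∀ i, fill (s.assign e i) o = u.assign e i := fun i => by
    funext a
    by_cases ha : a = e
    · subst ha; simp [fill, assign]
    · simp [fill, assign, hu, Function.update_of_ne ha]
  have hu0 : ∀ i, 0 ≤ marginal f e i u := fun i => hmon u e i hue
  have hus : ∀ i, marginal f e i u ≤ marginal f e i s := fun i => hsub.marginal_le i hsu hs hue
  have hsum : ∑ i, p i * f (fill (s.assign e i) o) = f u + ∑ i, p i * marginal f e i u := by
    have : f u = ∑ i, p i * f u := by rw [← Finset.sum_mul, hp1, one_mul]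
    rw [this, ← Finset.sum_add_distrib]
    exact Finset.sum_congr rfl fun i _ => by rw [hfill, marginal]; ring
  have hUs : 0 ≤ ∑ i, p i * marginal f e i u :=
    Finset.sum_nonneg fun i _ => mul_nonneg (hp0 i) (hu0 i)
  rw [hsum]
  -- If `o` gives `e` no type, the completion can only gain, by monotonicity.
  rcases hoe : o e with _ | j
  · have : fill s o = u := by
      rw [hu, eq_comm, Function.update_eq_self_iff]; simp [fill, hs, hoe]
    rw [this]
    linarith
  · have hfo : fill s o = u.assign e j := by
      rw [hu, assign, Function.update_idem, eq_comm, Function.update_eq_self_iff]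
      simp [fill, hs, hoe]
    have h1 : f (fill s o) = f u + marginal f e j u := by rw [hfo, marginal]; ring
    have h2 : p j * marginal f e j u ≤ ∑ i, p i * marginal f e i u :=
      Finset.single_le_sum (fun i _ => mul_nonneg (hp0 i) (hu0 i)) (Finset.mem_univ j)
    -- An estimated gain is a difference of two answers, so its error is at most `2 * ρ`.
    have h3 : (1 - p j) * marginal f e j s
        ≤ (1 - 1 / k) * ∑ i, p i * marginal f e i s + 2 * (2 * ρ) :=
      one_sub_typeProb_mul_le_of_abs_sub_le hgain (fun i => by
        have e1 := abs_le.1 hgood.1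
        have e2 := abs_le.1 (hgood.2 i)
        rw [marginal, abs_le]
        constructor <;> linarith) j
    have h4 := mul_le_mul_of_nonneg_left (hus j) (sub_nonneg.2 (typeProb_le_one _ j) : 0 ≤ 1 - p j)
    linarith

end KVec

/-! ## The law of an algorithm and expectations of its output -/

section Law

variable {A ι : Type}

/-- The expectation of `g` under the law of an algorithm, by recursion on the algorithm. -/
noncomputable def OracleAlg.expect [Fintype ι] (ans : ℕ → A → ℝ) :
    OracleAlg A ι → ℕ → (List A × A → ℝ) → ℝ
  | .ret a, _, g => g ([], a)
  | .query a next, q, g =>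
      OracleAlg.expect ans (next (ans q a)) (q + 1) fun r => g (a :: r.1, r.2)
  | .sample p next, q, g => ∑ i, (p i).toReal * OracleAlg.expect ans (next i) q g

/-- This replaces the infinite sum over transcripts by a recursion with finite sums. Every draw is
from a finite type, so no boundedness of `g` is needed. -/
theorem OracleAlg.hasSum_law [Fintype ι] (ans : ℕ → A → ℝ) (alg : OracleAlg A ι) :
    ∀ (q : ℕ) (g : List A × A → ℝ),
      HasSum (fun r => (alg.law ans q r).toReal * g r) (alg.expect ans q g) := by
  classical
  induction alg with
  | ret a =>
    intro q g
    convert hasSum_single (([], a) : List A × A) ?_ using 1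
    · simp [OracleAlg.law, OracleAlg.expect]
    · intro r hr
      simp [OracleAlg.law, PMF.pure_apply, hr]
  | query a next ih =>
    intro q g
    have hinj : Function.Injective fun r : List A × A => ((a :: r.1, r.2) : List A × A) := by
      rintro ⟨r1, r2⟩ ⟨r1', r2'⟩ h
      simpa using h
    rw [OracleAlg.expect]
    refine (hinj.hasSum_iff ?_).1 ?_
    · intro r hr
      have : (OracleAlg.query a next).law ans q r = 0 := by
        rw [OracleAlg.law, PMF.map_apply]
        refine ENNReal.tsum_eq_zero.2 fun r' => if_neg ?_
        rintro rfl
        exact hr ⟨r', rfl⟩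
      simp [this]
    · convert ih (ans q a) (q + 1) (fun r => g (a :: r.1, r.2)) using 2 with r
      have : (OracleAlg.query a next).law ans q (a :: r.1, r.2)
          = (next (ans q a)).law ans (q + 1) r := by
        rw [OracleAlg.law, PMF.map_apply, tsum_eq_single r]
        · simp
        · intro r' hr'
          exact if_neg fun h => hr' (hinj h).symm
      simp [Function.comp, this]
  | sample p next ih =>
    intro q g
    rw [OracleAlg.expect]
    have hlaw : (OracleAlg.sample p next).law ans q = p.bind fun i => (next i).law ans q := rfl
    have := hasSum_sum fun i (_ : i ∈ Finset.univ) => (ih i q g).mul_left (p i).toReal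
    rw [show (fun r => ((OracleAlg.sample p next).law ans q r).toReal * g r) =
      fun r => ∑ i, (p i).toReal * (((next i).law ans q r).toReal * g r) from ?_]
    · exact this
    funext r
    rw [hlaw, PMF.bind_apply, tsum_fintype, ENNReal.toReal_sum, Finset.sum_mul]
    · simp only [ENNReal.toReal_mul, mul_assoc]
    · exact fun i _ => ENNReal.mul_ne_top (PMF.apply_ne_top _ _) (PMF.apply_ne_top _ _)

/-- Without repetitions in `l` no recorded answer is overwritten, and the position of `i` in `l`
gives the number of its query. -/
theorem OracleAlg.expect_queryTypes {k : ℕ} (ans : ℕ → A → ℝ) (a : Fin k → A)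
    (next : (Fin k → ℝ) → OracleAlg A (Fin k)) {l : List (Fin k)} (hl : l.Nodup) :
    ∀ (h : Fin k → ℝ) (q : ℕ) (g : List A × A → ℝ),
      (queryTypes a next l h).expect ans q g =
        (next (fun i => if i ∈ l then ans (q + l.idxOf i) (a i) else h i)).expect ans
          (q + l.length) fun r => g (l.map a ++ r.1, r.2) := by
  induction l with
  | nil => intro h q g; simp [queryTypes]
  | cons i l ih =>
    intro h q g
    rw [List.nodup_cons] at hl
    rw [queryTypes, OracleAlg.expect, ih hl.2]
    have hlen : q + (i :: l).length = q + 1 + l.length := by simp; ring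
    rw [hlen]
    congr 2
    funext j
    by_cases hj : j = i
    · subst hj; simp [hl.1]
    · simp [hj, List.idxOf_cons_ne l (Ne.symm hj), add_assoc, add_comm 1]

end Law

/-! ### Expected output of the main loop for fixed answers -/

section Loop

variable {n k : ℕ} [NeZero k]

/-- The expectation of `g` at the output of the main loop, where `q` queries have been answered. -/
noncomputable def loopExpect (ans : ℕ → KVec n k → ℝ) (g : KVec n k → ℝ) :
    List (Fin n) → KVec n k → ℝ → ℕ → ℝ
  | [], s, _, _ => g s
  | e :: l, s, v, q => ∑ i : Fin k,
      typeProb (fun j : Fin k => ans (q + j) (s.assign e j) - v) i *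
        loopExpect ans g l (s.assign e i) (ans (q + i) (s.assign e i)) (q + k)

theorem toReal_typePMF (y : Fin k → ℝ) (i : Fin k) : (typePMF y i).toReal = typeProb y i := by
  simp [typePMF, typeProb_nonneg]

theorem expect_iwataLoop (ans : ℕ → KVec n k → ℝ) (g₀ : KVec n k → ℝ) (l : List (Fin n)) :
    ∀ (s : KVec n k) (v : ℝ) (q : ℕ) (g : List (KVec n k) × KVec n k → ℝ),
      (∀ r, r.1.length = k * l.length → g₀ r.2 ≤ g r) →
        loopExpect ans g₀ l s v q ≤ (iwataLoop l s v).expect ans q g := by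
  induction l with
  | nil =>
    intro s v q g hg
    exact hg ([], s) (by simp)
  | cons e l ih =>
    intro s v q g hg
    rw [iwataLoop, OracleAlg.expect_queryTypes ans _ _ (List.nodup_finRange k),
      OracleAlg.expect, loopExpect]
    simp only [List.mem_finRange, if_true, List.idxOf_finRange, List.length_finRange,
      toReal_typePMF]
    refine Finset.sum_le_sum fun i _ => mul_le_mul_of_nonneg_left ?_ (typeProb_nonneg _ _)
    refine ih _ _ _ _ fun r hr => hg (_ ++ r.1, r.2) ?_
    simp [hr]
    ring

/-- Every run makes one query for `0` and `k` for each element, so only transcripts with `n * k + 1`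
queries matter. -/
theorem loopExpect_le (ans : ℕ → KVec n k → ℝ) (g₀ : KVec n k → ℝ) (σ : Equiv.Perm (Fin n))
    (g : List (KVec n k) × KVec n k → ℝ)
    (hg : ∀ r : List (KVec n k) × KVec n k, r.1.length = n * k + 1 → g₀ r.2 ≤ g r) :
    loopExpect ans g₀ ((List.finRange n).map σ) (KVec.zero n k) (ans 0 (KVec.zero n k)) 1 ≤
      ∑' r, ((modifiedIwata σ).law ans 0 r).toReal * g r := by
  rw [(OracleAlg.hasSum_law ans (modifiedIwata σ) 0 g).tsum_eq, modifiedIwata, OracleAlg.expect]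
  refine expect_iwataLoop ans g₀ _ _ _ _ _ fun r hr => hg (_ :: r.1, r.2) ?_
  simp [hr, mul_comm]

/-- A lower bound for `g` at all vectors in which the processed elements have a type. -/
theorem le_loopExpect (ans : ℕ → KVec n k → ℝ) {g : KVec n k → ℝ} {c : ℝ} (l : List (Fin n)) :
    ∀ (s : KVec n k) (v : ℝ) (q : ℕ),
      (∀ x : KVec n k, (∀ e, e ∈ l ∨ s e ≠ none → x e ≠ none) → c ≤ g x) →
        c ≤ loopExpect ans g l s v q := by
  induction l with
  | nil =>
    intro s v q hg
    exact hg s fun e he => by simpa using he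
  | cons e l ih =>
    intro s v q hg
    rw [loopExpect]
    calc c = ∑ i : Fin k, typeProb (fun j : Fin k => ans (q + j) (s.assign e j) - v) i * c := by
          rw [← Finset.sum_mul, sum_typeProb, one_mul]
      _ ≤ _ := Finset.sum_le_sum fun i _ => mul_le_mul_of_nonneg_left
          (ih _ _ _ fun x hx => hg x fun a ha => hx a ?_) (typeProb_nonneg _ _)
    by_cases hae : a = e
    · right; subst hae; simp [KVec.assign]
    · simpa [hae, KVec.assign, Function.update_of_ne hae] using ha

end Loop

/-! ## Rewards of disjoint sets of rounds -/

section Rewards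

variable {A Ω : Type*} {X : ℕ → A → Ω → ℝ}

/-- The `σ`-algebra generated by the rewards in the rounds in `S`. -/
@[reducible] def roundsAlgebra (X : ℕ → A → Ω → ℝ) (S : Set ℕ) : MeasurableSpace Ω :=
  ⨆ t ∈ S, MeasurableSpace.comap (fun ω a => X t a ω) inferInstance

theorem roundsAlgebra_mono {S S' : Set ℕ} (h : S ⊆ S') :
    roundsAlgebra X S ≤ roundsAlgebra X S' :=
  biSup_mono h

theorem measurable_roundsAlgebra {S : Set ℕ} {t : ℕ} (ht : t ∈ S) (a : A) :
    Measurable[roundsAlgebra X S] (X t a) := by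
  have h1 : Measurable[MeasurableSpace.comap (fun ω a => X t a ω) inferInstance]
      (fun ω a => X t a ω) := comap_measurable _
  have h2 := (measurable_pi_apply a).comp h1
  exact h2.mono (le_biSup (fun t => MeasurableSpace.comap (fun ω a => X t a ω) inferInstance) ht)
    le_rfl

theorem measurable_cetcAnswer {m' : MeasurableSpace Ω} {m q : ℕ} {a : A}
    (h : ∀ j < m, Measurable[m'] (X (q * m + j) a)) :
    Measurable[m'] fun ω => cetcAnswer m X ω q a := by
  unfold cetcAnswer
  exact (Finset.measurable_fun_sum _ fun j hj => h j (Finset.mem_range.1 hj)).div_const _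

theorem measurable_cetcAnswer_roundsAlgebra {S : Set ℕ} {m q : ℕ}
    (h : Set.Ico (q * m) ((q + 1) * m) ⊆ S) (a : A) :
    Measurable[roundsAlgebra X S] fun ω => cetcAnswer m X ω q a :=
  measurable_cetcAnswer fun j hj => measurable_roundsAlgebra (h ⟨by omega, by
    rw [add_mul, one_mul]; omega⟩) a

namespace IsRewardProcess

variable [mΩ : MeasurableSpace Ω] {μ : Measure Ω}

theorem roundsAlgebra_le (hX : IsRewardProcess μ X) (S : Set ℕ) : roundsAlgebra X S ≤ mΩ :=
  iSup₂_le fun t _ => (measurable_pi_iff.2 fun a => hX.measurable t a).comap_le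

/-- Rewards within one round may be dependent, so independence is used only between disjoint sets of
rounds. -/
theorem integral_mul (hX : IsRewardProcess μ X) {S S' : Set ℕ} (hS : Disjoint S S') {W Z : Ω → ℝ}
    (hW : Measurable[roundsAlgebra X S] W) (hZ : Measurable[roundsAlgebra X S'] Z) :
    ∫ ω, W ω * Z ω ∂μ = (∫ ω, W ω ∂μ) * ∫ ω, Z ω ∂μ := by
  have hle : ∀ t, MeasurableSpace.comap (fun ω a => X t a ω) inferInstance ≤ mΩ :=
    fun t => (measurable_pi_iff.2 fun a => hX.measurable t a).comap_le
  have hi := indep_iSup_of_disjoint hle hX.indep hS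
  have hWZ : IndepFun W Z μ := (IndepFun_iff_Indep _ _ _).2
    (indep_of_indep_of_le_left (indep_of_indep_of_le_right hi hZ.comap_le) hW.comap_le)
  exact hWZ.integral_fun_mul_eq_mul_integral
    (hW.mono (hX.roundsAlgebra_le S) le_rfl).aestronglyMeasurable
    (hZ.mono (hX.roundsAlgebra_le S') le_rfl).aestronglyMeasurable

theorem integral_eq (hX : IsRewardProcess μ X) (t : ℕ) (a : A) :
    ∫ ω, X t a ω ∂μ = expectedReward μ X a :=
  (hX.identDistrib t a).integral_eq

variable [IsProbabilityMeasure μ]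

theorem integrable (hX : IsRewardProcess μ X) (t : ℕ) (a : A) : Integrable (X t a) μ :=
  Integrable.of_mem_Icc 0 1 (hX.measurable t a).aemeasurable (hX.mem_Icc t a)

theorem expectedReward_mem_Icc (hX : IsRewardProcess μ X) (a : A) :
    expectedReward μ X a ∈ Set.Icc (0 : ℝ) 1 := by
  refine ⟨integral_nonneg_of_ae ((hX.mem_Icc 0 a).mono fun ω h => h.1), ?_⟩
  have := integral_mono_ae (hX.integrable 0 a) (integrable_const (1 : ℝ))
    ((hX.mem_Icc 0 a).mono fun ω h => h.2)
  simpa [expectedReward] using this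

/-- Hoeffding's inequality for the empirical means in C-ETC. -/
theorem integral_exceeds_le (hX : IsRewardProcess μ X) {m : ℕ} (hm : m ≠ 0) {ρ : ℝ} (hρ : 0 ≤ ρ)
    (q : ℕ) (a : A) :
    ∫ ω, exceeds ρ (cetcAnswer m X ω q a - expectedReward μ X a) ∂μ ≤
      2 * Real.exp (-2 * m * ρ ^ 2) := by
  have hm0 : (0 : ℝ) < m := by positivity
  set Y : ℕ → Ω → ℝ := fun j ω => X (q * m + j) a ω - expectedReward μ X a with hY
  have hYind : iIndepFun Y μ := by
    have h1 : iIndepFun (fun j ω a => X (q * m + j) a ω) μ :=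
      hX.indep.precomp (g := fun j => q * m + j) fun i j h => by simpa using h
    exact h1.comp (fun _ x => x a - expectedReward μ X a)
      fun _ => (measurable_pi_apply a).sub_const _
  have hYsub : ∀ j, HasSubgaussianMGF (Y j) ((‖(1 : ℝ) - 0‖₊ / 2) ^ 2) μ := fun j => by
    have := hasSubgaussianMGF_of_mem_Icc (hX.measurable (q * m + j) a).aemeasurable
      (hX.mem_Icc (q * m + j) a)
    rwa [hX.integral_eq] at this
  have hnind : iIndepFun (fun j => -Y j) μ := hYind.comp (fun _ x => -x) fun _ => measurable_neg
  have hsum : ∀ ω, ∑ j ∈ Finset.range m, Y j ω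
      = m * (cetcAnswer m X ω q a - expectedReward μ X a) := fun ω => by
    simp only [hY, Finset.sum_sub_distrib, cetcAnswer, Finset.sum_const, Finset.card_range,
      nsmul_eq_mul]
    field_simp
  have hmρ : 0 ≤ m * ρ := by positivity
  have h1 := HasSubgaussianMGF.measure_sum_range_ge_le_of_iIndepFun hYind (n := m)
    (fun j _ => hYsub j) hmρ
  have h2 := HasSubgaussianMGF.measure_sum_range_ge_le_of_iIndepFun hnind (n := m)
    (fun j _ => (hYsub j).neg) hmρ
  -- A variable in `[0,1]` has sub-Gaussian parameter `1/4` after centering; this produces the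
  -- exponent `2mρ²`.
  have he : -(m * ρ) ^ 2 / (2 * m * (((‖(1 : ℝ) - 0‖₊ / 2) ^ 2 : NNReal) : ℝ))
      = -2 * m * ρ ^ 2 := by
    simp
    field_simp
  rw [he] at h1 h2
  have hmeas : Measurable fun ω => cetcAnswer m X ω q a - expectedReward μ X a :=
    (measurable_cetcAnswer fun j _ => hX.measurable _ a).sub_const _
  have hset : MeasurableSet {ω | ρ < |cetcAnswer m X ω q a - expectedReward μ X a|} :=
    measurableSet_lt measurable_const hmeas.abs
  have hint : ∫ ω, exceeds ρ (cetcAnswer m X ω q a - expectedReward μ X a) ∂μ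
      = μ.real {ω | ρ < |cetcAnswer m X ω q a - expectedReward μ X a|} := by
    rw [← integral_indicator_one hset]
    rfl
  rw [hint]
  calc _ ≤ μ.real ({ω | m * ρ ≤ ∑ j ∈ Finset.range m, Y j ω} ∪
          {ω | m * ρ ≤ ∑ j ∈ Finset.range m, (-Y j) ω}) := by
        refine measureReal_mono fun ω hω => ?_
        simp only [Set.mem_union, Set.mem_ofPred_eq, Pi.neg_apply, Finset.sum_neg_distrib, hsum]
          at hω ⊢
        rcases lt_abs.1 hω with h | h
        · left; gcongr
        · right; rw [← mul_neg]; gcongr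
    _ ≤ _ := measureReal_union_le _ _
    _ ≤ _ := by linarith

end IsRewardProcess

end Rewards

/-! ## The offline algorithm with empirical means -/

section Exploitation

variable {n k : ℕ} [NeZero k]

theorem measurable_typeProb (i : Fin k) : Measurable fun y : Fin k → ℝ => typeProb y i := by
  have h : ∀ j, Measurable fun y : Fin k → ℝ => max (y j) 0 ^ (k - 1) := fun j => by fun_prop
  have hs : Measurable fun y : Fin k → ℝ => ∑ j, max (y j) 0 ^ (k - 1) :=
    Finset.measurable_fun_sum _ fun j _ => h j
  unfold typeProb
  exact Measurable.ite (measurableSet_eq_fun hs measurable_const).compl ((h i).div hs)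
    measurable_const

theorem measurable_exceeds (ρ : ℝ) : Measurable (exceeds ρ) :=
  Measurable.ite (measurableSet_lt measurable_const measurable_abs) measurable_const
    measurable_const

theorem loopExpect_le_of_le (ans : ℕ → KVec n k → ℝ) {g : KVec n k → ℝ} {c : ℝ}
    (hg : ∀ x, g x ≤ c) (l : List (Fin n)) :
    ∀ (s : KVec n k) (v : ℝ) (q : ℕ), loopExpect ans g l s v q ≤ c := by
  induction l with
  | nil => intro s v q; exact hg s
  | cons e l ih =>
    intro s v q
    rw [loopExpect]
    calc _ ≤ ∑ i : Fin k, typeProb (fun j : Fin k => ans (q + j) (s.assign e j) - v) i * c :=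
          Finset.sum_le_sum fun i _ => mul_le_mul_of_nonneg_left (ih _ _ _) (typeProb_nonneg _ _)
      _ = c := by rw [← Finset.sum_mul, sum_typeProb, one_mul]

theorem measurable_loopExpect {Ω : Type*} [MeasurableSpace Ω] {ans : Ω → ℕ → KVec n k → ℝ}
    (hans : ∀ q a, Measurable fun ω => ans ω q a) {g : Ω → KVec n k → ℝ}
    (hg : ∀ x, Measurable fun ω => g ω x) (l : List (Fin n)) :
    ∀ (s : KVec n k) (v : Ω → ℝ) (q : ℕ), Measurable v →
      Measurable fun ω => loopExpect (ans ω) (g ω) l s (v ω) q := by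
  induction l with
  | nil => intro s v q _; exact hg s
  | cons e l ih =>
    intro s v q hv
    simp only [loopExpect]
    refine Finset.measurable_fun_sum _ fun i _ => Measurable.mul ?_ (ih _ _ _ (hans _ _))
    exact (measurable_typeProb i).comp
      (measurable_pi_iff.2 fun j => (hans _ (s.assign e j)).sub hv)

variable {Ω : Type*} [mΩ : MeasurableSpace Ω] {μ : Measure Ω} [IsProbabilityMeasure μ]
  {X : ℕ → KVec n k → Ω → ℝ}

/-- The weight `W` is the probability, given the answers so far, that the draws lead to `s`. It
depends only on rounds before `q * m`, so it is independent of the answers to come and of the reward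
in round `t`. It need not be independent of `v`, which may have influenced the last draw; hence the
deviation of `v` stays in a separate term. Each element costs `2kη`: `kη` for the new answers in its
own step, and `kη` for the same answers in the role of `v` in the next one. -/
theorem integral_mul_loopExpect_ge (hX : IsRewardProcess μ X)
    (hsub : KVec.KSubmodular (expectedReward μ X)) (hmon : KVec.IsMonotone (expectedReward μ X))
    (o : KVec n k) {m t : ℕ} {ρ η : ℝ} (hρ : 0 ≤ ρ)
    (hη : ∀ q a, ∫ ω, exceeds ρ (cetcAnswer m X ω q a - expectedReward μ X a) ∂μ ≤ η)
    (l : List (Fin n)) (hl : l.Nodup) :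
    ∀ (s : KVec n k) (v W : Ω → ℝ) (q : ℕ), (∀ e, s e = none ↔ e ∈ l) →
      Measurable[roundsAlgebra X (Set.Iio (q * m))] v →
      Measurable[roundsAlgebra X (Set.Iio (q * m))] W →
      (∀ ω, W ω ∈ Set.Icc (0 : ℝ) 1) → (q + k * l.length) * m ≤ t →
      (expectedReward μ X (s.fill o) + (1 - 1 / k) * expectedReward μ X s) * ∫ ω, W ω ∂μ
          - (l.length * (4 * ρ + 2 * k * η) * ∫ ω, W ω ∂μ
            + ∫ ω, W ω * exceeds ρ (v ω - expectedReward μ X s) ∂μ) ≤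
        (2 - 1 / k) * ∫ ω, W ω *
          loopExpect (cetcAnswer m X ω) (fun x => X t x ω) l s (v ω) q ∂μ := by
  set f := expectedReward μ X with hf
  have hf01 : ∀ x, f x ∈ Set.Icc (0 : ℝ) 1 := hX.expectedReward_mem_Icc
  have hX01 : ∀ᵐ ω ∂μ, ∀ x, X t x ω ∈ Set.Icc (0 : ℝ) 1 := ae_all_iff.2 fun x => hX.mem_Icc t x
  have hansm : ∀ q a, Measurable fun ω => cetcAnswer m X ω q a := fun q a =>
    measurable_cetcAnswer fun j _ => hX.measurable _ a
  have hbdd : ∀ {W Z : Ω → ℝ}, Measurable W → Measurable Z → (∀ ω, W ω ∈ Set.Icc (0 : ℝ) 1) →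
      (∀ᵐ ω ∂μ, Z ω ∈ Set.Icc (0 : ℝ) 1) → Integrable (fun ω => W ω * Z ω) μ := by
    intro W Z hW hZ hW1 hZ1
    refine Integrable.of_mem_Icc 0 1 (hW.mul hZ).aemeasurable ?_
    filter_upwards [hZ1] with ω h
    exact ⟨mul_nonneg (hW1 ω).1 h.1, mul_le_one₀ (hW1 ω).2 h.1 h.2⟩
  have hexc : ∀ d : ℝ, exceeds ρ d ∈ Set.Icc (0 : ℝ) 1 := fun d =>
    ⟨exceeds_nonneg ρ d, exceeds_le_one ρ d⟩
  induction l with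
  | nil =>
    intro s v W q hs hv hW hW1 hq
    have hfill : s.fill o = s := by
      funext e
      have : s e ≠ none := fun h => by simpa using (hs e).1 h
      simp [KVec.fill, this]
    -- Round `t` comes after all exploration, so its reward has mean `f s` independently of the
    -- path.
    have hdisj : Disjoint (Set.Iio (q * m)) {t} := by
      rw [Set.disjoint_singleton_right]
      simpa using hq
    have hmul := hX.integral_mul hdisj hW (measurable_roundsAlgebra (Set.mem_singleton t) s)
    rw [hX.integral_eq] at hmul
    have h0 : 0 ≤ ∫ ω, W ω * exceeds ρ (v ω - f s) ∂μ :=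
      integral_nonneg fun ω => mul_nonneg (hW1 ω).1 (exceeds_nonneg _ _)
    simp only [loopExpect, hfill, hmul, List.length_nil, Nat.cast_zero]
    linarith
  | cons e l ih =>
    intro s v W q hs hv hW hW1 hq
    rw [List.nodup_cons] at hl
    have hle := hX.roundsAlgebra_le
    have hvm := hv.mono (hle _) le_rfl
    have hWm := hW.mono (hle _) le_rfl
    set h : Fin k → Ω → ℝ := fun i ω => cetcAnswer m X ω (q + i) (s.assign e i) with hh
    set p : Fin k → Ω → ℝ := fun i ω => typeProb (fun j => h j ω - v ω) i with hp
    set F : KVec n k → ℝ := fun x => f (x.fill o) + (1 - 1 / k) * f x with hF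
    have hmono : roundsAlgebra X (Set.Iio (q * m)) ≤ roundsAlgebra X (Set.Iio ((q + k) * m)) :=
      roundsAlgebra_mono (Set.Iio_subset_Iio (Nat.mul_le_mul_right m (by omega)))
    have hh' : ∀ i, Measurable[roundsAlgebra X (Set.Iio ((q + k) * m))] (h i) := fun i =>
      measurable_cetcAnswer_roundsAlgebra (fun t ht => lt_of_lt_of_le ht.2
        (Nat.mul_le_mul_right m (by omega))) _
    have hv' := hv.mono hmono le_rfl
    have hW' := hW.mono hmono le_rfl
    have hp' : ∀ i, Measurable[roundsAlgebra X (Set.Iio ((q + k) * m))] (p i) := fun i =>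
      (measurable_typeProb i).comp
        (@measurable_pi_iff _ _ _ (roundsAlgebra X (Set.Iio ((q + k) * m))) _ _ |>.2
          fun j => (hh' j).sub hv')
    have hpm : ∀ i, Measurable (p i) := fun i => (hp' i).mono (hle _) le_rfl
    have hp01 : ∀ i ω, p i ω ∈ Set.Icc (0 : ℝ) 1 := fun i ω =>
      ⟨typeProb_nonneg _ _, typeProb_le_one _ _⟩
    have hWp01 : ∀ i ω, W ω * p i ω ∈ Set.Icc (0 : ℝ) 1 := fun i ω =>
      ⟨mul_nonneg (hW1 ω).1 (hp01 i ω).1, mul_le_one₀ (hW1 ω).2 (hp01 i ω).1 (hp01 i ω).2⟩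
    have hWint : Integrable W μ :=
      Integrable.of_mem_Icc 0 1 hWm.aemeasurable (Filter.Eventually.of_forall hW1)
    have hWpint : ∀ i, Integrable (fun ω => W ω * p i ω) μ := fun i =>
      hbdd hWm (hpm i) hW1 (Filter.Eventually.of_forall (hp01 i))
    have hvexc : Measurable fun ω => exceeds ρ (v ω - f s) :=
      (measurable_exceeds ρ).comp (hvm.sub_const _)
    have hhexc : ∀ i, Measurable fun ω => exceeds ρ (h i ω - f (s.assign e i)) := fun i =>
      (measurable_exceeds ρ).comp ((hansm _ _).sub_const _)
    have hvint : Integrable (fun ω => W ω * exceeds ρ (v ω - f s)) μ :=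
      hbdd hWm hvexc hW1 (Filter.Eventually.of_forall fun ω => hexc _)
    have hhint : ∀ i, Integrable (fun ω => W ω * exceeds ρ (h i ω - f (s.assign e i))) μ :=
      fun i => hbdd hWm (hhexc i) hW1 (Filter.Eventually.of_forall fun ω => hexc _)
    have hW0 : 0 ≤ ∫ ω, W ω ∂μ := integral_nonneg fun ω => (hW1 ω).1
    -- the answers for `s.assign e i` are independent of `W`
    have hdev : ∀ i, ∫ ω, W ω * exceeds ρ (h i ω - f (s.assign e i)) ∂μ ≤ η * ∫ ω, W ω ∂μ := by
      intro i
      have hd : Disjoint (Set.Iio (q * m)) (Set.Ici ((q + i) * m)) := by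
        rw [Set.disjoint_left]
        intro a ha hb
        have h1 : a < q * m := ha
        have h2 : (q + i) * m ≤ a := hb
        have := Nat.mul_le_mul_right m (Nat.le_add_right q i)
        omega
      have hm1 : Measurable[roundsAlgebra X (Set.Ici ((q + i) * m))]
          fun ω => exceeds ρ (h i ω - f (s.assign e i)) :=
        (measurable_exceeds ρ).comp
          ((measurable_cetcAnswer_roundsAlgebra (fun t ht => ht.1) _).sub_const _)
      rw [hX.integral_mul hd hW hm1, mul_comm]
      exact mul_le_mul_of_nonneg_right (hη _ _) hW0
    have hsum1 : ∑ i, ∫ ω, W ω * p i ω ∂μ = ∫ ω, W ω ∂μ := by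
      rw [← integral_finsetSum _ fun i _ => hWpint i]
      refine integral_congr_ae (Filter.Eventually.of_forall fun ω => ?_)
      simp only [← Finset.mul_sum]
      rw [sum_typeProb, mul_one]
    -- the step for `e`
    have hstep : F s * ∫ ω, W ω ∂μ - (4 * ρ * ∫ ω, W ω ∂μ
          + ∫ ω, W ω * exceeds ρ (v ω - f s) ∂μ
          + ∑ i, ∫ ω, W ω * exceeds ρ (h i ω - f (s.assign e i)) ∂μ) ≤
        ∑ i, F (s.assign e i) * ∫ ω, W ω * p i ω ∂μ := by
      have i1 : Integrable (fun ω => F s * W ω) μ := hWint.const_mul _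
      have i2 : Integrable (fun ω => 4 * ρ * W ω) μ := hWint.const_mul _
      have i3 : Integrable (fun ω => 4 * ρ * W ω + W ω * exceeds ρ (v ω - f s)) μ := i2.add hvint
      have i4 : Integrable (fun ω => ∑ i, W ω * exceeds ρ (h i ω - f (s.assign e i))) μ :=
        integrable_finsetSum _ fun i _ => hhint i
      have i5 : Integrable (fun ω => 4 * ρ * W ω + W ω * exceeds ρ (v ω - f s)
          + ∑ i, W ω * exceeds ρ (h i ω - f (s.assign e i))) μ := i3.add i4
      have hI : ∫ ω, (F s * W ω - (4 * ρ * W ω + W ω * exceeds ρ (v ω - f s)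
            + ∑ i, W ω * exceeds ρ (h i ω - f (s.assign e i)))) ∂μ ≤
          ∫ ω, ∑ i, F (s.assign e i) * (W ω * p i ω) ∂μ := by
        refine integral_mono ?_ ?_ fun ω => ?_
        · exact i1.sub i5
        · exact integrable_finsetSum _ fun i _ => (hWpint i).const_mul _
        · have := mul_le_mul_of_nonneg_left (KVec.fill_add_le_sum_typeProb hsub hmon hf01 o
            ((hs e).2 (by simp)) hρ (v ω) fun i => h i ω) (hW1 ω).1
          rw [Finset.mul_sum] at this
          simp only [← Finset.mul_sum]
          calc _ = _ := by ring
            _ ≤ _ := this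
            _ = _ := Finset.sum_congr rfl fun i _ => by ring
      rw [integral_sub i1 i5, integral_add i3 i4, integral_add i2 hvint,
        integral_finsetSum _ fun i _ => hhint i,
        integral_finsetSum _ fun i _ => (hWpint i).const_mul _] at hI
      simpa only [integral_const_mul] using hI
    -- the remaining steps
    have hrec : ∀ i, F (s.assign e i) * ∫ ω, W ω * p i ω ∂μ
          - (l.length * (4 * ρ + 2 * k * η) * ∫ ω, W ω * p i ω ∂μ
            + ∫ ω, W ω * exceeds ρ (h i ω - f (s.assign e i)) ∂μ) ≤
        (2 - 1 / k) * ∫ ω, W ω * p i ω * loopExpect (cetcAnswer m X ω) (fun x => X t x ω) l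
          (s.assign e i) (h i ω) (q + k) ∂μ := by
      intro i
      have h1 := ih hl.2 (s.assign e i) (h i) (fun ω => W ω * p i ω) (q + k) (fun a => by
        by_cases ha : a = e
        · subst ha; simp [KVec.assign, hl.1]
        · simp [KVec.assign, hs a, ha]) (hh' i)
        (hW'.mul (hp' i)) (hWp01 i) (by
          convert hq using 2; rw [List.length_cons]; ring)
      -- `p i` depends on `h i`, so it is bounded by `1`; what remains is a product of independent
      -- factors. Summing over `i` then costs the factor `k`.
      have h2 : ∫ ω, W ω * p i ω * exceeds ρ (h i ω - f (s.assign e i)) ∂μ ≤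
          ∫ ω, W ω * exceeds ρ (h i ω - f (s.assign e i)) ∂μ := by
        refine integral_mono (hbdd (hWm.mul (hpm i)) (hhexc i) (hWp01 i)
          (Filter.Eventually.of_forall fun ω => hexc _)) (hhint i) fun ω => ?_
        exact mul_le_mul_of_nonneg_right
          (mul_le_of_le_one_right (hW1 ω).1 (hp01 i ω).2) (exceeds_nonneg _ _)
      linarith
    have hlint : ∀ i, Integrable (fun ω => W ω * p i ω * loopExpect (cetcAnswer m X ω)
        (fun x => X t x ω) l (s.assign e i) (h i ω) (q + k)) μ := fun i => by
      refine hbdd (hWm.mul (hpm i)) (measurable_loopExpect hansm (fun x => hX.measurable t x) l _ _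
        _ (hansm _ _)) (hWp01 i) ?_
      filter_upwards [hX01] with ω hω
      exact ⟨le_loopExpect _ _ _ _ _ fun x _ => (hω x).1,
        loopExpect_le_of_le _ (fun x => (hω x).2) _ _ _ _⟩
    have hloop : ∫ ω, W ω * loopExpect (cetcAnswer m X ω) (fun x => X t x ω) (e :: l) s (v ω) q ∂μ
        = ∑ i, ∫ ω, W ω * p i ω * loopExpect (cetcAnswer m X ω) (fun x => X t x ω) l
          (s.assign e i) (h i ω) (q + k) ∂μ := by
      rw [← integral_finsetSum _ fun i _ => hlint i]
      refine integral_congr_ae (Filter.Eventually.of_forall fun ω => ?_)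
      simp only [loopExpect, Finset.mul_sum, mul_assoc]
      rfl
    have hR := Finset.sum_le_sum fun i (_ : i ∈ Finset.univ) => hrec i
    have hD : ∑ i, ∫ ω, W ω * exceeds ρ (h i ω - f (s.assign e i)) ∂μ
        ≤ k * (η * ∫ ω, W ω ∂μ) := by
      have := Finset.sum_le_sum fun i (_ : i ∈ Finset.univ) => hdev i
      simpa using this
    rw [Finset.sum_sub_distrib, Finset.sum_add_distrib, ← Finset.mul_sum, ← Finset.mul_sum, hsum1]
      at hR
    rw [hloop, List.length_cons]
    push_cast
    linarith

end Exploitation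

/-! ## The regret of C-ETC -/

theorem OracleAlg.expect_mem_Icc {A ι : Type} [Fintype ι] (ans : ℕ → A → ℝ) (alg : OracleAlg A ι)
    {a b : ℝ} : ∀ (q : ℕ) (g : List A × A → ℝ), (∀ r, g r ∈ Set.Icc a b) →
      alg.expect ans q g ∈ Set.Icc a b := by
  induction alg with
  | ret x => intro q g hg; exact hg _
  | query x next ih => intro q g hg; exact ih _ _ _ fun r => hg _
  | sample p next ih =>
    intro q g hg
    have hp : ∑ i, (p i).toReal = 1 := by
      have h := p.tsum_coe
      rw [tsum_fintype] at h
      rw [← ENNReal.toReal_sum fun i _ => p.apply_ne_top i, h, ENNReal.toReal_one]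
    rw [OracleAlg.expect]
    constructor
    · calc a = ∑ i, (p i).toReal * a := by rw [← Finset.sum_mul, hp, one_mul]
        _ ≤ _ := Finset.sum_le_sum fun i _ =>
          mul_le_mul_of_nonneg_left (ih i q g hg).1 ENNReal.toReal_nonneg
    · calc _ ≤ ∑ i, (p i).toReal * b := Finset.sum_le_sum fun i _ =>
          mul_le_mul_of_nonneg_left (ih i q g hg).2 ENNReal.toReal_nonneg
        _ = b := by rw [← Finset.sum_mul, hp, one_mul]

section Regret

variable {n k : ℕ} [NeZero k]

theorem loopExpect_sum (ans : ℕ → KVec n k → ℝ) (S : Finset ℕ) (g : ℕ → KVec n k → ℝ)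
    (l : List (Fin n)) : ∀ (s : KVec n k) (v : ℝ) (q : ℕ),
      loopExpect ans (fun x => ∑ t ∈ S, g t x) l s v q =
        ∑ t ∈ S, loopExpect ans (g t) l s v q := by
  induction l with
  | nil => intro s v q; rfl
  | cons e l ih =>
    intro s v q
    simp only [loopExpect, ih, Finset.mul_sum]
    exact Finset.sum_comm

theorem measurable_expect_iwataLoop {Ω : Type*} [MeasurableSpace Ω] {ans : Ω → ℕ → KVec n k → ℝ}
    (hans : ∀ q a, Measurable fun ω => ans ω q a) (l : List (Fin n)) :
    ∀ (s : KVec n k) (v : Ω → ℝ) (q : ℕ) (g : Ω → List (KVec n k) × KVec n k → ℝ), Measurable v →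
      (∀ r, Measurable fun ω => g ω r) →
      Measurable fun ω => (iwataLoop l s (v ω)).expect (ans ω) q (g ω) := by
  induction l with
  | nil => intro s v q g _ hg; exact hg _
  | cons e l ih =>
    intro s v q g hv hg
    simp only [iwataLoop, OracleAlg.expect_queryTypes _ _ _ (List.nodup_finRange k),
      OracleAlg.expect, List.mem_finRange, if_true, List.idxOf_finRange, List.length_finRange,
      toReal_typePMF]
    refine Finset.measurable_fun_sum _ fun i _ => Measurable.mul ?_
      (ih _ _ _ _ (hans _ _) fun r => hg _)
    exact (measurable_typeProb i).comp
      (measurable_pi_iff.2 fun j => (hans _ (s.assign e j)).sub hv)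

variable {Ω : Type*} [MeasurableSpace Ω] {μ : Measure Ω} {X : ℕ → KVec n k → Ω → ℝ}

/-- The expected reward in round `t` of the output of the offline algorithm. -/
noncomputable def exploitReward (μ : Measure Ω) (X : ℕ → KVec n k → Ω → ℝ)
    (σ : Equiv.Perm (Fin n)) (m t : ℕ) : ℝ :=
  ∫ ω, loopExpect (cetcAnswer m X ω) (fun x => X t x ω) ((List.finRange n).map σ)
    (KVec.zero n k) (cetcAnswer m X ω 0 (KVec.zero n k)) 1 ∂μ

variable [IsProbabilityMeasure μ]

theorem integrable_loopExpect (hX : IsRewardProcess μ X) (m t : ℕ) (l : List (Fin n))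
    (s a : KVec n k) (q : ℕ) :
    Integrable (fun ω => loopExpect (cetcAnswer m X ω) (fun x => X t x ω) l s
      (cetcAnswer m X ω 0 a) q) μ := by
  have hansm : ∀ q a, Measurable fun ω => cetcAnswer m X ω q a := fun q a =>
    measurable_cetcAnswer fun j _ => hX.measurable _ a
  refine Integrable.of_mem_Icc 0 1 (measurable_loopExpect hansm (fun x => hX.measurable t x) l _ _
    _ (hansm _ _)).aemeasurable ?_
  filter_upwards [ae_all_iff.2 fun x => hX.mem_Icc t x] with ω hω
  exact ⟨le_loopExpect _ _ _ _ _ fun x _ => (hω x).1,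
    loopExpect_le_of_le _ (fun x => (hω x).2) _ _ _ _⟩

/-- Rewards are almost surely nonnegative, so the exploration rounds may be dropped; in all later
rounds the action is the output. -/
theorem sum_exploitReward_le (hX : IsRewardProcess μ X) (σ : Equiv.Perm (Fin n)) (δ N : ℝ)
    (T : ℕ) :
    ∑ t ∈ Finset.Ico (cetcPlays T δ N * (n * k + 1)) T,
        exploitReward μ X σ (cetcPlays T δ N) t ≤
      cetcExpectedTotalReward μ X (modifiedIwata σ) δ N T := by
  unfold exploitReward cetcExpectedTotalReward
  set m := cetcPlays T δ N
  have hansm : ∀ q a, Measurable fun ω => cetcAnswer m X ω q a := fun q a =>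
    measurable_cetcAnswer fun j _ => hX.measurable _ a
  have h01 : ∀ᵐ ω ∂μ, ∀ t x, X t x ω ∈ Set.Icc (0 : ℝ) 1 :=
    ae_all_iff.2 fun t => ae_all_iff.2 fun x => hX.mem_Icc t x
  rw [← integral_finsetSum _ fun t _ => integrable_loopExpect hX m t _ _ _ _]
  refine integral_mono_ae
    (integrable_finsetSum _ fun t _ => integrable_loopExpect hX m t _ _ _ _) ?_ ?_
  · simp only [fun ω => (OracleAlg.hasSum_law (cetcAnswer m X ω) (modifiedIwata σ) 0
      fun r => ∑ t ∈ Finset.range T, X t (cetcAction m r t) ω).tsum_eq]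
    refine Integrable.of_mem_Icc 0 (T : ℝ) (Measurable.aemeasurable ?_) ?_
    · exact measurable_expect_iwataLoop hansm _ _ _ _ _ (hansm _ _) fun r =>
        Finset.measurable_fun_sum _ fun t _ => hX.measurable _ _
    · filter_upwards [h01] with ω hω
      refine OracleAlg.expect_mem_Icc _ _ _ _ fun r => ⟨Finset.sum_nonneg fun t _ => (hω _ _).1, ?_⟩
      simpa using Finset.sum_le_sum fun t (_ : t ∈ Finset.range T) => (hω t (cetcAction m r t)).2
  · filter_upwards [h01] with ω hω
    rw [← loopExpect_sum]
    refine loopExpect_le _ _ σ _ fun r hr => ?_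
    refine le_trans (Finset.sum_le_sum fun t ht => ?_) (Finset.sum_le_sum_of_subset_of_nonneg
      (f := fun t => X t (cetcAction m r t) ω) (fun t ht => ?_) fun t _ _ => (hω _ _).1)
    · have : cetcAction m r t = r.2 := if_neg (by
        rw [hr, not_lt]; exact (Finset.mem_Ico.1 ht).1)
      rw [this]
    · exact Finset.mem_range.2 (Finset.mem_Ico.1 ht).2

/-- If only one vector gives types to all elements, then it is the output. -/
theorem expectedReward_le_exploitReward (hX : IsRewardProcess μ X) (σ : Equiv.Perm (Fin n))
    (m t : ℕ) {a : KVec n k} (ha : ∀ x : KVec n k, (∀ e, x e ≠ none) → x = a) :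
    expectedReward μ X a ≤ exploitReward μ X σ m t := by
  rw [← hX.integral_eq t a]
  refine integral_mono_ae (hX.integrable t a) (integrable_loopExpect hX m t _ _ _ _)
    (Filter.Eventually.of_forall fun ω => le_loopExpect _ _ _ _ _ fun x hx => ?_)
  rw [ha x fun e => hx e (Or.inl (by simpa using σ.surjective e))]

theorem ratio_nonneg_le_one : 0 ≤ (k : ℝ) / (2 * k - 1) ∧ (k : ℝ) / (2 * k - 1) ≤ 1 := by
  have hk : (1 : ℝ) ≤ k := by exact_mod_cast NeZero.one_le
  exact ⟨div_nonneg (by linarith) (by linarith), by rw [div_le_one (by linarith)]; linarith⟩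

/-- The output of the offline algorithm with empirical means is nearly `k / (2 k - 1)`-optimal. -/
theorem le_exploitReward (hX : IsRewardProcess μ X)
    (hsub : KVec.KSubmodular (expectedReward μ X)) (hmon : KVec.IsMonotone (expectedReward μ X))
    (σ : Equiv.Perm (Fin n)) {m t : ℕ} (hm : m ≠ 0) (ht : m * (n * k + 1) ≤ t) {ρ η : ℝ}
    (hρ : 0 ≤ ρ) (hη : 2 * Real.exp (-2 * m * ρ ^ 2) = η) (o : KVec n k) :
    (k : ℝ) / (2 * k - 1) * expectedReward μ X o - (n * (4 * ρ + 2 * k * η) + η) ≤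
      exploitReward μ X σ m t := by
  have hη' := fun q a => (hX.integral_exceeds_le hm hρ q a).trans_eq hη
  have hη0 : 0 ≤ η := by rw [← hη]; positivity
  have hnd : ((List.finRange n).map σ).Nodup := (List.nodup_finRange n).map σ.injective
  -- The loop is entered with weight `1` after one query, whose deviation contributes the single
  -- extra `η`.
  have h := integral_mul_loopExpect_ge hX hsub hmon o (t := t) hρ hη' _ hnd (KVec.zero n k)
    (fun ω => cetcAnswer m X ω 0 (KVec.zero n k)) (fun _ => 1) 1
    (fun e => by simpa [KVec.zero] using σ.surjective e)
    (measurable_cetcAnswer_roundsAlgebra (fun t ht => by simpa using ht.2) _)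
    measurable_const (fun _ => by simp) (by
      rw [List.length_map, List.length_finRange]; convert ht using 1; ring)
  have h0 : (KVec.zero n k).fill o = o := by funext e; simp [KVec.fill, KVec.zero]
  simp only [h0, one_mul, integral_const, probReal_univ, smul_eq_mul, mul_one, List.length_map,
    List.length_finRange] at h
  change _ ≤ (2 - 1 / (k : ℝ)) * exploitReward μ X σ m t at h
  have hk : (1 : ℝ) ≤ k := by exact_mod_cast NeZero.one_le
  have h1 := hη' 0 (KVec.zero n k)
  have hf0 := (hX.expectedReward_mem_Icc (KVec.zero n k)).1
  have hk1 : 0 ≤ 1 - 1 / (k : ℝ) := by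
    rw [sub_nonneg, div_le_one (by linarith)]; exact hk
  have hα := ratio_nonneg_le_one (k := k)
  have hαk : (k : ℝ) / (2 * k - 1) * (2 - 1 / k) = 1 := by
    have : (2 * k - 1 : ℝ) ≠ 0 := by linarith
    rw [div_mul_eq_mul_div, div_eq_one_iff_eq this]
    field_simp
  have hD : 0 ≤ n * (4 * ρ + 2 * k * η) + η := by positivity
  have h2 : expectedReward μ X o - (n * (4 * ρ + 2 * k * η) + η) ≤
      (2 - 1 / (k : ℝ)) * exploitReward μ X σ m t := by
    have := mul_nonneg hk1 hf0
    linarith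
  have h3 := mul_le_mul_of_nonneg_left h2 hα.1
  rw [← mul_assoc, hαk, one_mul] at h3
  have h4 := mul_le_of_le_one_left hD hα.2
  linarith

/-- An exploration round costs at most `α * F ≤ 1` and a later one at most `D`. If exploration fills
the horizon, the regret is at most `T`, which the first term covers. -/
theorem cetcRegret_le (hX : IsRewardProcess μ X) (σ : Equiv.Perm (Fin n)) (δ N : ℝ) (T : ℕ)
    {D : ℝ} (hD : 0 ≤ D) (h : ∀ t, cetcPlays T δ N * (n * k + 1) ≤ t →
      (k : ℝ) / (2 * k - 1) * (⨆ a, expectedReward μ X a) - D ≤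
        exploitReward μ X σ (cetcPlays T δ N) t) :
    cetcRegret μ X (modifiedIwata σ) (k / (2 * k - 1)) δ N T ≤
      cetcPlays T δ N * (n * k + 1) + T * D := by
  have h1 := sum_exploitReward_le hX σ δ N T
  unfold cetcRegret
  set α := (k : ℝ) / (2 * k - 1)
  set m := cetcPlays T δ N
  set F := ⨆ a, expectedReward μ X a
  have hα : 0 ≤ α ∧ α ≤ 1 := ratio_nonneg_le_one
  obtain ⟨o, ho⟩ : ∃ o, expectedReward μ X o = F := exists_eq_ciSup_of_finite
  have hF := hX.expectedReward_mem_Icc o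
  rw [ho] at hF
  have hαF : α * F ≤ 1 := mul_le_one₀ hα.2 hF.1 hF.2
  have hT : (0 : ℝ) ≤ T := by positivity
  have hTD : 0 ≤ T * D := mul_nonneg hT hD
  rcases le_total T (m * (n * k + 1)) with hle | hle
  · rw [Finset.Ico_eq_empty_of_le hle, Finset.sum_empty] at h1
    have h2 : (T : ℝ) ≤ m * (n * k + 1) := by exact_mod_cast hle
    have h3 := mul_le_mul_of_nonneg_left hαF hT
    linarith
  · have h2 := (Finset.card_nsmul_le_sum (Finset.Ico (m * (n * k + 1)) T) _ _ fun t ht =>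
      h t (Finset.mem_Ico.1 ht).1).trans h1
    rw [Nat.card_Ico, nsmul_eq_mul, Nat.cast_sub hle] at h2
    push_cast at h2
    have h3 : (0 : ℝ) ≤ m * (n * k + 1) := by positivity
    have h4 := mul_le_mul_of_nonneg_left hαF h3
    have h5 := mul_nonneg h3 hD
    linarith

end Regret

/-! ## The choice of the parameters -/

theorem rpow_two_thirds_eq {y : ℝ} (hy : 0 ≤ y) : y ^ (2 / 3 : ℝ) = (y ^ (1 / 3 : ℝ)) ^ 2 := by
  rw [← Real.rpow_natCast, ← Real.rpow_mul hy]; norm_num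

theorem rpow_third_pow {y : ℝ} (hy : 0 ≤ y) : (y ^ (1 / 3 : ℝ)) ^ 3 = y := by
  rw [← Real.rpow_natCast, ← Real.rpow_mul hy]; norm_num

/-- In cube roots `d, a, b, c` of `16 - 2/k, k, T, log T` all terms become polynomial. The powers of
`n` cancel in `m`, and `4 ≤ d² ≤ 8` places `m` before rounding between `2b²c/a²` and `4b²c/a²`. The
choice of `ρ` makes the exponential equal to `1/T²`. -/
theorem cetcPlays_bound {n k T : ℕ} (hn : 1 ≤ n) (hk : 1 ≤ k) (hT : 2 ≤ T) (hnk : n * k ≤ T)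
    {m : ℕ} (hm : m = cetcPlays T ((16 - 2 / k) * n) (n * k)) {ρ : ℝ}
    (hρ : ρ = √(Real.log T / m)) :
    m ≠ 0 ∧ (m * (n * k + 1) : ℝ) + T * (n * (4 * ρ + 2 * k * (2 * Real.exp (-2 * m * ρ ^ 2)))
        + 2 * Real.exp (-2 * m * ρ ^ 2)) ≤
      28 * n * (k : ℝ) ^ (1 / 3 : ℝ) * (T : ℝ) ^ (2 / 3 : ℝ) * Real.log T ^ (1 / 3 : ℝ) := by
  have hn' : (1 : ℝ) ≤ n := by exact_mod_cast hn
  have hk' : (1 : ℝ) ≤ k := by exact_mod_cast hk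
  have hT' : (2 : ℝ) ≤ T := by exact_mod_cast hT
  have hnk' : (n : ℝ) * k ≤ T := by exact_mod_cast hnk
  have hkT : (k : ℝ) ≤ T := by nlinarith
  -- The bound `1/8` is a cube, giving `c ≥ 1/2`; this lets the rounding of `m` and the constant
  -- terms be absorbed in `B`.
  have hlog : (1 / 8 : ℝ) ≤ Real.log T := by
    have := Real.log_le_log (by norm_num) hT'
    linarith [Real.log_two_gt_d9]
  have hkinv : 2 / (k : ℝ) ≤ 2 ∧ 0 ≤ 2 / (k : ℝ) :=
    ⟨div_le_self (by norm_num) hk', by positivity⟩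
  have hd0 : 0 ≤ 16 - 2 / (k : ℝ) := by linarith
  set d := (16 - 2 / (k : ℝ)) ^ (1 / 3 : ℝ) with hd
  set a := (k : ℝ) ^ (1 / 3 : ℝ) with ha
  set b := (T : ℝ) ^ (1 / 3 : ℝ) with hb
  set c := Real.log T ^ (1 / 3 : ℝ) with hc
  have hd3 : d ^ 3 = 16 - 2 / (k : ℝ) := rpow_third_pow hd0
  have ha3 : a ^ 3 = k := rpow_third_pow (by linarith)
  have hb3 : b ^ 3 = T := rpow_third_pow (by linarith)
  have hc3 : c ^ 3 = Real.log T := rpow_third_pow (by linarith)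
  have hdpos : 0 ≤ d := Real.rpow_nonneg hd0 _
  have ha1 : 1 ≤ a := Real.one_le_rpow hk' (by norm_num)
  have hb1 : 1 ≤ b := Real.one_le_rpow (by linarith) (by norm_num)
  have hab : a ≤ b := Real.rpow_le_rpow (by linarith) hkT (by norm_num)
  have hc0 : 0 ≤ c := Real.rpow_nonneg (by linarith) _
  have hc2 : 1 / 2 ≤ c := by
    by_contra! hlt
    have := pow_lt_pow_left₀ hlt hc0 (n := 3) (by norm_num)
    rw [hc3] at this; norm_num at this; linarith
  have hd2 : 2 ≤ d := by
    by_contra! hlt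
    have := pow_lt_pow_left₀ hlt hdpos (n := 3) (by norm_num)
    rw [hd3] at this; norm_num at this; linarith
  have hd8 : d ^ 2 ≤ 8 := by
    have : d ^ 3 ≤ 16 := by rw [hd3]; linarith
    nlinarith
  set x := d ^ 2 * b ^ 2 * c / (2 * a ^ 2) with hx
  have hmx : m = ⌈x⌉₊ := by
    rw [hm, cetcPlays, hx, Real.mul_rpow hd0 (by positivity), Real.mul_rpow (by positivity)
      (by positivity), rpow_two_thirds_eq hd0, rpow_two_thirds_eq (y := T) (by positivity),
      rpow_two_thirds_eq (y := k) (by positivity), ← hd, ← hb, ← hc, ← ha]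
    congr 1
    have : (n : ℝ) ^ (2 / 3 : ℝ) ≠ 0 := (Real.rpow_pos_of_pos (by linarith) _).ne'
    field_simp
  have ha0 : 0 < a := by linarith
  have hb0 : 0 < b := by linarith
  have hxl : 2 * b ^ 2 * c / a ^ 2 ≤ x := by
    rw [hx, div_le_div_iff₀ (by positivity) (by positivity)]
    have : 4 ≤ d ^ 2 := by nlinarith
    have h2 : 0 ≤ b ^ 2 * c * a ^ 2 := by positivity
    nlinarith only [this, h2, mul_le_mul_of_nonneg_right this h2]
  have hxu : x * a ^ 2 ≤ 4 * b ^ 2 * c := by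
    rw [hx, div_mul_eq_mul_div, div_le_iff₀ (by positivity)]
    have h2 : 0 ≤ b ^ 2 * c * a ^ 2 := by positivity
    nlinarith only [hd8, h2, mul_le_mul_of_nonneg_right hd8 h2]
  have hx0 : 0 < x := lt_of_lt_of_le (by positivity) hxl
  have hm0 : m ≠ 0 := by rw [hmx]; exact (Nat.ceil_pos.2 hx0).ne'
  have hmle : (m : ℝ) ≤ x + 1 := by rw [hmx]; exact (Nat.ceil_lt_add_one hx0.le).le
  have hmge : x ≤ m := by rw [hmx]; exact Nat.le_ceil x
  have hmpos : (0 : ℝ) < m := by positivity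
  have hρ0 : 0 ≤ ρ := by rw [hρ]; positivity
  have hρ2 : m * ρ ^ 2 = Real.log T := by
    rw [hρ, Real.sq_sqrt (by positivity)]; field_simp
  have hexp : Real.exp (-2 * m * ρ ^ 2) = 1 / (T : ℝ) ^ 2 := by
    rw [mul_assoc, hρ2, neg_mul, Real.exp_neg, two_mul, Real.exp_add, Real.exp_log (by linarith)]
    rw [one_div, sq]
  refine ⟨hm0, ?_⟩
  rw [hexp, rpow_two_thirds_eq (by positivity : (0 : ℝ) ≤ T), ← hb]
  set B := n * a * b ^ 2 * c with hB
  have hB0 : 1 / 2 ≤ B := by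
    have h1 : 1 ≤ n * a * b ^ 2 :=
      one_le_mul_of_one_le_of_one_le (one_le_mul_of_one_le_of_one_le hn' ha1) (one_le_pow₀ hb1)
    exact hc2.trans (le_mul_of_one_le_left hc0 h1)
  -- exploration
  have h1 : (m * (n * k + 1) : ℝ) ≤ 12 * B := by
    have hnk1 : (1 : ℝ) ≤ n * k := one_le_mul_of_one_le_of_one_le hn' hk'
    have e1 : (m * (n * k + 1) : ℝ) ≤ (x + 1) * (2 * (n * a ^ 3)) := by
      rw [ha3]
      exact mul_le_mul hmle (by linarith) (by positivity) (by positivity)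
    have e2 : a ^ 2 ≤ 2 * (b ^ 2 * c) := by
      have : a ^ 2 ≤ b ^ 2 := pow_le_pow_left₀ ha0.le hab 2
      nlinarith only [this, mul_le_mul_of_nonneg_left hc2 (sq_nonneg b)]
    have e3 : (x + 1) * (2 * (n * a ^ 3)) = 2 * (n * a) * (x * a ^ 2 + a ^ 2) := by ring
    have e4 : 2 * (n * a) * (x * a ^ 2 + a ^ 2) ≤ 2 * (n * a) * (6 * (b ^ 2 * c)) :=
      mul_le_mul_of_nonneg_left (by linarith) (by positivity)
    calc _ ≤ _ := e1
      _ = _ := e3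
      _ ≤ _ := e4
      _ = 12 * B := by rw [hB]; ring
  -- estimation errors
  have h2 : T * ρ ≤ a * b ^ 2 * c := by
    have e1 : ρ ≤ c * a / b := by
      rw [hρ]
      refine Real.sqrt_le_iff.2 ⟨by positivity, ?_⟩
      rw [div_le_iff₀ hmpos, ← hc3]
      calc c ^ 3 ≤ 2 * c ^ 3 := by linarith only [pow_nonneg hc0 3]
        _ = (c * a / b) ^ 2 * (2 * b ^ 2 * c / a ^ 2) := by field_simp
        _ ≤ (c * a / b) ^ 2 * m := mul_le_mul_of_nonneg_left (hxl.trans hmge) (by positivity)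
    calc T * ρ ≤ b ^ 3 * (c * a / b) := by
          rw [hb3]; exact mul_le_mul_of_nonneg_left e1 (by positivity)
      _ = a * b ^ 2 * c := by field_simp
  have h3 : T * (n * (2 * k * (2 * (1 / (T : ℝ) ^ 2))) + 2 * (1 / (T : ℝ) ^ 2)) ≤ 6 := by
    have : T * (n * (2 * k * (2 * (1 / (T : ℝ) ^ 2))) + 2 * (1 / (T : ℝ) ^ 2))
        = (4 * (n * k) + 2) / T := by field_simp; ring
    rw [this, div_le_iff₀ (by linarith)]
    nlinarith only [hT', hnk']
  have h4 : n * (T * ρ) ≤ B := by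
    rw [hB]
    calc n * (T * ρ) ≤ n * (a * b ^ 2 * c) := mul_le_mul_of_nonneg_left h2 (by positivity)
      _ = _ := by ring
  have h5 : 28 * n * a * b ^ 2 * c = 28 * B := by rw [hB]; ring
  rw [h5]
  -- `28 = 12 + 4 + 12`: exploration, the errors `4nρT`, and the failure terms, which are at most `6
  -- ≤ 12 * B`.
  linarith only [h1, h3, h4, hB0]

theorem mainTheorem2 :
    ∃ C : ℝ, 0 < C ∧
      ∀ (n k : ℕ) [NeZero k] (σ : Equiv.Perm (Fin n))
        (Ω : Type*) [MeasurableSpace Ω] (μ : Measure Ω) [IsProbabilityMeasure μ]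
        (X : ℕ → KVec n k → Ω → ℝ) (T : ℕ),
        IsRewardProcess μ X →
        KVec.KSubmodular (expectedReward μ X) →
        KVec.IsMonotone (expectedReward μ X) →
        max ((n : ℝ) * k) (2 * √2 * k / (16 - 2 / k)) ≤ T →
        cetcRegret μ X (modifiedIwata σ) (k / (2 * k - 1)) ((16 - 2 / k) * n) (n * k) T ≤
          C * n * (k : ℝ) ^ (1 / 3 : ℝ) * (T : ℝ) ^ (2 / 3 : ℝ) *
            Real.log T ^ (1 / 3 : ℝ) := by
  refine ⟨28, by norm_num, ?_⟩
  intro n k _ σ Ω _ μ _ X T hX hsub hmon hT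
  have hk : 1 ≤ k := NeZero.one_le
  have hk' : (1 : ℝ) ≤ k := by exact_mod_cast hk
  have hnk : n * k ≤ T := by exact_mod_cast (le_max_left _ _).trans hT
  obtain ⟨o, ho⟩ : ∃ o, expectedReward μ X o = ⨆ a, expectedReward μ X a :=
    exists_eq_ciSup_of_finite
  by_cases hmain : 1 ≤ n ∧ 2 ≤ T
  · obtain ⟨hm, hle⟩ := cetcPlays_bound hmain.1 hk hmain.2 hnk rfl rfl
    refine le_trans (cetcRegret_le hX σ _ _ T ?_ fun t ht => ?_) hle
    · positivity
    · rw [← ho]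
      exact le_exploitReward hX hsub hmon σ hm ht (Real.sqrt_nonneg _) rfl o
  -- the degenerate cases, in which only one vector gives types to all elements
  have hdeg : n = 0 ∨ (n = 1 ∧ k = 1 ∧ T = 1) := by
    rcases Nat.eq_zero_or_pos n with h | h
    · exact Or.inl h
    · right
      have h1 : T ≤ 1 := by omega
      have h2 : 1 ≤ n * k := Nat.mul_pos h hk
      have h3 : n * k = 1 := by omega
      have h4 := Nat.eq_one_of_mul_eq_one_right h3
      have h5 := Nat.eq_one_of_mul_eq_one_left h3
      omega
  obtain ⟨a, ha, hoa⟩ : ∃ a : KVec n k, (∀ x : KVec n k, (∀ e, x e ≠ none) → x = a) ∧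
      expectedReward μ X o ≤ expectedReward μ X a := by
    rcases hdeg with rfl | ⟨rfl, rfl, -⟩
    · exact ⟨o, fun x _ => Subsingleton.elim _ _, le_rfl⟩
    · refine ⟨fun _ => some 0, fun x hx => ?_, ?_⟩
      · funext e
        rcases hxe : x e with _ | i
        · exact absurd hxe (hx e)
        · rw [Subsingleton.elim i 0]
      · rcases ho0 : o 0 with _ | i
        · have h := hmon o 0 0 ho0
          have h1 : o.assign 0 0 = fun _ => some 0 := by
            funext e; rw [Subsingleton.elim e 0]; simp [KVec.assign]
          rw [KVec.marginal, h1] at h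
          linarith
        · have h1 : o = fun _ => some 0 := by
            funext e; rw [Subsingleton.elim e 0, ho0, Subsingleton.elim i 0]
          rw [h1]
  -- The numerator in `m` vanishes, so there is no exploration, and `D = 0` suffices below.
  have hplays : cetcPlays T ((16 - 2 / k) * n) (n * k) = 0 := by
    rcases hdeg with rfl | ⟨-, -, rfl⟩ <;> simp [cetcPlays]
  have hα := ratio_nonneg_le_one (k := k)
  have hf := (hX.expectedReward_mem_Icc o).1
  have hr := cetcRegret_le hX σ ((16 - 2 / k) * n) (n * k) T le_rfl fun t _ => by
    rw [← ho, sub_zero]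
    exact (mul_le_of_le_one_left hf hα.2).trans
      (hoa.trans (expectedReward_le_exploitReward hX σ _ t ha))
  rw [hplays] at hr
  refine hr.trans ?_
  have : 0 ≤ Real.log T := Real.log_natCast_nonneg T
  simp only [Nat.cast_zero, zero_mul, mul_zero, add_zero]
  positivity
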